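/- Let $\mathbb{D}=\{z\in\mathbb{C}:|z|<1\}$ and let $\mathbb{T}=\partial\mathbb{D}$ carry the normalized Lebesgue measure $m$, $m(\mathbb{T})=1$. The Hardy space $H^2=H^2(\mathbb{D})$ is the closure of the analytic polynomials in $L^2(\mathbb{T},m)$, with the norm of $L^2(\mathbb{T},m)$; a function $f\in H^2$ is extended analytically to $\mathbb{D}$ by $f(z)=\sum_{n\ge 0}\hat f(n)z^n$, where $\hat f(n)=\int_{\mathbb{T}}f(\xi)\,\overline{\xi}^{\,n}\,dm(\xi)$. For $\lambda\in\mathbb{D}$ let $$k_\lambda(z)=\frac{(1-|\lambda|^2)^{1/2}}{1-z\overline{\lambda}},\qquad z\in\mathbb{D},$$ be the normalized reproducing kernel of $H^2$ at $\lambda$. **Theorem.** Let $\mu$ be a non-negative Borel measure on $\mathbb{D}$, with closed support $\operatorname{supp}\mu\subseteq\mathbb{D}$ (relative to $\mathbb{D}$), and suppose that $$A:=\sup_{\lambda\in\operatorname{supp}\mu}\int_{\mathbb{D}}|k_\lambda(z)|^2\,d\mu(z)<\infty$$ (with $A=0$ if $\mu=0$). Then $$\int_{\mathbb{D}}|f(z)|^2\,d\mu(z)\le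 2eA\,\|f\|_{H^2}^2\qquad\text{for every } f\in H^2.$$ -/

import Mathlib

open MeasureTheory
open scoped ENNReal

noncomputable section

/-- The open unit disc `𝔻` in the complex plane. -/
abbrev unitDisc : Set ℂ := Metric.ball (0 : ℂ) 1

instance fact_two_pi_pos : Fact (0 < 2 * Real.pi) := ⟨Real.two_pi_pos⟩

/-- `L²(𝕋, m)`, where `𝕋` is the unit circle, parametrized by the angle in `ℝ / 2πℤ`, and `m` is
Lebesgue measure on it, normalized by `m(𝕋) = 1`. -/
abbrev CircleL2 : Type := Lp ℂ 2 (AddCircle.haarAddCircle (T := 2 * Real.pi))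

/-- The linear map that restricts an analytic polynomial to the unit circle, as an element of
`L²(𝕋, m)`: the polynomial `p` goes to the class of the function `θ ↦ p(e^{iθ})`. -/
def polyToCircleL2 : Polynomial ℂ →ₗ[ℂ] CircleL2 :=
  (ContinuousMap.toLp (E := ℂ) 2 (AddCircle.haarAddCircle (T := 2 * Real.pi)) ℂ).toLinearMap ∘ₗ
    Polynomial.toAddCircle.toLinearMap

/-- The Hardy space `H²`: the closure of the analytic polynomials in `L²(𝕋, m)`, with the norm
of `L²(𝕋, m)`. -/
def hardyH2 : Submodule ℂ CircleL2 :=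
  (LinearMap.range polyToCircleL2).topologicalClosure

/-- The analytic extension to the unit disc of `f ∈ H²`: `f(z) = ∑_{n ≥ 0} f̂(n) zⁿ`, where
`f̂(n) = ∫_𝕋 f(ξ) ξ⁻ⁿ dm(ξ)` are the Fourier coefficients of the boundary function. -/
def discExtension (f : CircleL2) (z : ℂ) : ℂ :=
  ∑' n : ℕ, fourierCoeff f (n : ℤ) * z ^ n

/-- The normalized reproducing (Szegő) kernel of `H²` at the point `a` of the disc:
`k_a(z) = (1 - |a|²)^{1/2} / (1 - z ā)`. -/
def szegoKernel (a z : ℂ) : ℂ :=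
  (Real.sqrt (1 - ‖a‖ ^ 2) : ℂ) / (1 - z * (starRingEnd ℂ) a)

/-- `sup_{a ∈ supp μ} ∫_𝔻 |k_a|² dμ`, with values in `[0, ∞]`, for a non-negative Borel measure `μ`
on the disc; here `supp μ` is the closed support of `μ`, relative to the disc. -/
def kernelTestConst (μ : Measure unitDisc) : ℝ≥0∞ :=
  ⨆ a ∈ μ.support, ∫⁻ z : unitDisc, ‖szegoKernel a z‖ₑ ^ 2 ∂μ

end

/-! The embedding is proved pointwise first, with an exponential weight adapted to each point, and
then integrated. Take `μ` of compact support in the disc and `c > 0` with `c ≥ 2A`. For a point `a`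
let `S_a(ξ) = ∫_{|z| ≥ |a|} |k_z(ξ)|² dμ(z)` be the balayage of the part of `μ` at least as far out
as `a`. It is the boundary value of `Re H`, with `H` a Herglotz transform analytic across the
circle.

The Poisson formula for the square of `f exp(-H/(2c))` gives `|f(a)|² ≤ exp(Re H(a)/c) ∫ |f|²
exp(-S_a/c) |k_a|² dm`. Restricting to `|z| ≥ |a|` makes `Re H(a)` at most twice the kernel integral
at `a`, hence at most `c`, so the loss is a factor `e`
(`enorm_sq_le_lintegral_exp_neg_outerBalayage`).

Now integrate in `a` and swap. For fixed `ξ`, `S_a(ξ)` is the tail mass of `|k_z(ξ)|² dμ(z)` ordered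
by `|z|`, so the inner integral is a Stieltjes form of `∫ exp(-s/c) ds ≤ c`
(`lintegral_exp_neg_measure_Ici_le`). The total constant is `e·c`. Exhausting the disc, passing from
polynomials to `H²`, and letting `c` decrease to `2A` finish the proof. -/

/-! ### Exponential integrals of tail masses -/

/-- The set is an up-closed interval, and a compact subset with least element `a` lies in `[a, ∞)`,
whose mass is at most `t`; inner regularity concludes. Atoms are allowed, which is why only an
inequality holds. -/
theorem measure_setOf_measure_Ici_le (ν : Measure ℝ) [IsFiniteMeasure ν] (t : ℝ≥0∞) :
    ν {x | ν (Set.Ici x) ≤ t} ≤ t := by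
  have hoc : Set.OrdConnected {x | ν (Set.Ici x) ≤ t} :=
    ⟨fun x hx y _ z hz => (measure_mono (Set.Ici_subset_Ici.2 hz.1)).trans hx⟩
  rw [hoc.measurableSet.measure_eq_iSup_isCompact]
  refine iSup₂_le fun K hK => iSup_le fun hc => ?_
  rcases K.eq_empty_or_nonempty with rfl | hne
  · simp
  · obtain ⟨a, ha, hmin⟩ := hc.exists_isLeast hne
    exact (measure_mono fun y hy => hmin hy).trans (hK ha)

theorem lintegral_exp_neg_Ioi {c : ℝ} (hc : 0 < c) (a : ℝ) :
    ∫⁻ t in Set.Ioi a, ENNReal.ofReal (Real.exp (-t / c) / c) =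
      ENNReal.ofReal (Real.exp (-a / c)) := by
  have hd : ∀ x ∈ Set.Ici a, HasDerivAt (fun t => -Real.exp (-t / c)) (Real.exp (-x / c) / c) x := by
    intro x _
    exact (((hasDerivAt_neg' x).div_const c).exp).neg.congr_deriv (by ring)
  have hlim : Filter.Tendsto (fun t => -Real.exp (-t / c)) Filter.atTop (nhds (-0)) := by
    refine (Real.tendsto_exp_atBot.comp ?_).neg
    exact (Filter.tendsto_neg_atTop_atBot).atBot_div_const hc
  have hi := integrableOn_Ioi_deriv_of_nonneg' hd (fun x _ => by positivity) hlim
  rw [← ofReal_integral_eq_lintegral_ofReal hi (ae_of_all _ fun x => by positivity),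
    integral_Ioi_of_hasDerivAt_of_tendsto' hd hi hlim]
  simp

theorem lintegral_mul_exp_neg_Ioi {c : ℝ} (hc : 0 < c) :
    ∫⁻ t in Set.Ioi (0 : ℝ), ENNReal.ofReal t * ENNReal.ofReal (Real.exp (-t / c) / c) =
      ENNReal.ofReal c := by
  have hd : ∀ x ∈ Set.Ici (0 : ℝ), HasDerivAt (fun t => -((t + c) * Real.exp (-t / c)))
      (x * (Real.exp (-x / c) / c)) x := by
    intro x _
    exact (((hasDerivAt_id' x).add_const c).mul
      ((hasDerivAt_neg' x).div_const c).exp).neg.congr_deriv (by field_simp; ring)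
  have hlim : Filter.Tendsto (fun t => -((t + c) * Real.exp (-t / c))) Filter.atTop
      (nhds (-0)) := by
    refine Filter.Tendsto.neg ?_
    have h1 := (Real.tendsto_pow_mul_exp_neg_atTop_nhds_zero 1).comp
      (Filter.tendsto_id.atTop_div_const hc)
    have h2 := (Real.tendsto_exp_neg_atTop_nhds_zero).comp
      (Filter.tendsto_id.atTop_div_const hc)
    have h3 := (h1.add h2).const_mul c
    simp only [add_zero, mul_zero] at h3
    refine h3.congr fun t => ?_
    simp [neg_div]; field_simp
  have hpos : ∀ x ∈ Set.Ioi (0 : ℝ), 0 ≤ x * (Real.exp (-x / c) / c) := fun x hx => by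
    have : (0 : ℝ) < x := hx
    positivity
  have hi := integrableOn_Ioi_deriv_of_nonneg' hd hpos hlim
  rw [← setLIntegral_congr_fun (f := fun x => ENNReal.ofReal (x * (Real.exp (-x / c) / c)))
    measurableSet_Ioi (fun x hx => ENNReal.ofReal_mul (le_of_lt hx)),
    ← ofReal_integral_eq_lintegral_ofReal hi
      ((ae_restrict_iff' measurableSet_Ioi).2 (ae_of_all _ hpos)),
    integral_Ioi_of_hasDerivAt_of_tendsto' hd hi hlim]
  simp

/-- Layer cake: write `exp(-s/c)` as `∫_s^∞ exp(-t/c)/c dt` and swap; the points with tail mass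
below `t` have mass at most `t`, leaving `∫ t exp(-t/c)/c dt = c`. -/
theorem lintegral_exp_neg_measure_Ici_le (ν : Measure ℝ) [IsFiniteMeasure ν] {c : ℝ}
    (hc : 0 < c) :
    ∫⁻ x, ENNReal.ofReal (Real.exp (-(ν (Set.Ici x)).toReal / c)) ∂ν ≤ ENNReal.ofReal c := by
  have hanti : Antitone fun x => (ν (Set.Ici x)).toReal := fun x y h =>
    ENNReal.toReal_mono (measure_ne_top _ _) (measure_mono (Set.Ici_subset_Ici.2 h))
  have hm : MeasurableSet {q : ℝ × ℝ | (ν (Set.Ici q.1)).toReal < q.2} :=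
    measurableSet_lt (hanti.measurable.comp measurable_fst) measurable_snd
  calc ∫⁻ x, ENNReal.ofReal (Real.exp (-(ν (Set.Ici x)).toReal / c)) ∂ν
      = ∫⁻ x, (∫⁻ t, {q : ℝ × ℝ | (ν (Set.Ici q.1)).toReal < q.2}.indicator
          (fun q => ENNReal.ofReal (Real.exp (-q.2 / c) / c)) (x, t)) ∂ν := by
        refine lintegral_congr fun x => ?_
        rw [← lintegral_exp_neg_Ioi hc, ← lintegral_indicator measurableSet_Ioi]
        rfl
    _ = ∫⁻ t, ∫⁻ x, {q : ℝ × ℝ | (ν (Set.Ici q.1)).toReal < q.2}.indicator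
          (fun q => ENNReal.ofReal (Real.exp (-q.2 / c) / c)) (x, t) ∂ν := by
        refine lintegral_lintegral_swap (Measurable.aemeasurable ?_)
        exact Measurable.indicator (by fun_prop) hm
    _ ≤ ∫⁻ t, (Set.Ioi (0 : ℝ)).indicator
          (fun t => ENNReal.ofReal t * ENNReal.ofReal (Real.exp (-t / c) / c)) t := by
        refine lintegral_mono fun t => ?_
        by_cases ht : 0 < t
        · rw [Set.indicator_of_mem (show t ∈ Set.Ioi 0 from ht)]
          calc _ ≤ ∫⁻ x, {x | ν (Set.Ici x) ≤ ENNReal.ofReal t}.indicator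
                (fun _ => ENNReal.ofReal (Real.exp (-t / c) / c)) x ∂ν := by
                refine lintegral_mono fun x => ?_
                refine Set.indicator_apply_le' (fun h => ?_) fun _ => zero_le
                rw [Set.indicator_of_mem]
                exact ENNReal.le_ofReal_iff_toReal_le (measure_ne_top _ _) ht.le |>.2 (le_of_lt h)
            _ ≤ _ := by
                refine (lintegral_indicator_const_le _ _).trans ?_
                rw [mul_comm]
                gcongr
                exact measure_setOf_measure_Ici_le ν _
        · rw [Set.indicator_of_notMem (show t ∉ Set.Ioi 0 from ht)]
          refine le_of_eq ((lintegral_congr fun x => Set.indicator_of_notMem ?_ _).trans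
            lintegral_zero)
          exact fun h => ht (ENNReal.toReal_nonneg.trans_lt h)
    _ = ENNReal.ofReal c := by
        rw [lintegral_indicator measurableSet_Ioi, lintegral_mul_exp_neg_Ioi hc]

theorem lintegral_exp_neg_measure_ge_le {α : Type*} [MeasurableSpace α] (ν : Measure α)
    [IsFiniteMeasure ν] {ρ : α → ℝ} (hρ : Measurable ρ) {c : ℝ} (hc : 0 < c) :
    ∫⁻ x, ENNReal.ofReal (Real.exp (-(ν {y | ρ x ≤ ρ y}).toReal / c)) ∂ν ≤
      ENNReal.ofReal c := by
  have hanti : Antitone fun x => (ν.map ρ (Set.Ici x)).toReal := fun x y h =>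
    ENNReal.toReal_mono (measure_ne_top _ _) (measure_mono (Set.Ici_subset_Ici.2 h))
  have := lintegral_exp_neg_measure_Ici_le (ν.map ρ) hc
  rw [lintegral_map (by have := hanti.measurable; fun_prop) hρ] at this
  convert this using 7 with x
  rw [Measure.map_apply hρ measurableSet_Ici]
  rfl

/-! ### Szegő kernel and Poisson formula -/

theorem enorm_szegoKernel_sq {a : ℂ} (ha : ‖a‖ < 1) (z : ℂ) :
    ‖szegoKernel a z‖ₑ ^ 2 =
      ENNReal.ofReal ((1 - ‖a‖ ^ 2) / ‖1 - z * (starRingEnd ℂ) a‖ ^ 2) := by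
  have h : 0 ≤ 1 - ‖a‖ ^ 2 := by nlinarith [norm_nonneg a]
  rw [← ofReal_norm, ← ENNReal.ofReal_pow (norm_nonneg _), szegoKernel, norm_div, div_pow,
    Complex.norm_real, Real.norm_eq_abs, sq_abs, Real.sq_sqrt h]

theorem norm_one_sub_mul_conj_of_norm_eq_one {w ξ : ℂ} (h : ‖ξ‖ = 1) :
    ‖1 - ξ * (starRingEnd ℂ) w‖ = ‖ξ - w‖ := by
  have h1 : ξ * (starRingEnd ℂ) ξ = 1 := by simp [Complex.mul_conj, Complex.normSq_eq_norm_sq, h]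
  rw [show 1 - ξ * (starRingEnd ℂ) w = ξ * (starRingEnd ℂ) (ξ - w) by rw [map_sub, mul_sub, h1],
    norm_mul, h, one_mul, RCLike.norm_conj]

theorem integral_haarAddCircle_eq_circleAverage {E : Type*} [NormedAddCommGroup E]
    [NormedSpace ℝ E] (f : ℂ → E) :
    ∫ t, f (AddCircle.toCircle t) ∂(AddCircle.haarAddCircle (T := 2 * Real.pi)) =
      Real.circleAverage f 0 1 := by
  rw [AddCircle.integral_haarAddCircle, Real.circleAverage_def,
    ← AddCircle.intervalIntegral_preimage _ 0, zero_add]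
  congr 1
  refine intervalIntegral.integral_congr fun θ _ => ?_
  simp [AddCircle.toCircle_apply_mk, circleMap, Circle.coe_exp]

/-- On the circle `|k_w|²` is the Poisson kernel at `w`; apply the Poisson formula to the analytic
function `g²` and take absolute values. -/
theorem enorm_sq_le_lintegral_szegoKernel {g : ℂ → ℂ}
    (hg : DiffContOnCl ℂ g (Metric.ball 0 1)) {w : ℂ} (hw : ‖w‖ < 1) :
    ‖g w‖ₑ ^ 2 ≤ ∫⁻ t, ‖g (AddCircle.toCircle t)‖ₑ ^ 2 *
      ‖szegoKernel w (AddCircle.toCircle t)‖ₑ ^ 2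
        ∂(AddCircle.haarAddCircle (T := 2 * Real.pi)) := by
  have h := (hg.smul hg).circleAverage_poissonKernel_smul (w := w) (by simpa using hw)
  rw [← integral_haarAddCircle_eq_circleAverage] at h
  have h2 : ‖g w‖ₑ ^ 2 = ‖g w • g w‖ₑ := by simp [sq, enorm_mul]
  rw [h2, ← h]
  refine (enorm_integral_le_lintegral_enorm _).trans (lintegral_mono fun t => le_of_eq ?_)
  have h1 : ‖(AddCircle.toCircle t : ℂ)‖ = 1 := Circle.norm_coe _
  rw [enorm_szegoKernel_sq hw, norm_one_sub_mul_conj_of_norm_eq_one h1]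
  have h0 : 0 ≤ 1 - ‖w‖ ^ 2 := by nlinarith [norm_nonneg w]
  simp only [Pi.smul_apply', smul_eq_mul, poissonKernel_def, sub_zero, h1, one_pow, enorm_smul,
    enorm_mul]
  rw [Real.enorm_of_nonneg (by positivity)]
  ring

/-! ### Herglotz transform of a measure supported away from the circle -/

/-- The transform `w ↦ ∫ (1 + z̄ w) / (1 - z̄ w) dν(z)`, whose real part on the unit circle is the
balayage of `ν`. -/
noncomputable def herglotzTransform (ν : Measure unitDisc) (w : ℂ) : ℂ :=
  ∫ z : unitDisc, (1 + (starRingEnd ℂ) (z : ℂ) * w) / (1 - (starRingEnd ℂ) (z : ℂ) * w) ∂ν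

section
variable {ν : Measure unitDisc} [IsFiniteMeasure ν] {r : ℝ}

theorem le_norm_one_sub_conj_mul {z w : ℂ} {R : ℝ} (hz : ‖z‖ ≤ r) (hw : ‖w‖ ≤ R) :
    1 - r * R ≤ ‖1 - (starRingEnd ℂ) z * w‖ := by
  have h1 : ‖(starRingEnd ℂ) z * w‖ ≤ r * R := by
    rw [norm_mul, RCLike.norm_conj]
    exact mul_le_mul hz hw (norm_nonneg _) ((norm_nonneg _).trans hz)
  have := norm_sub_norm_le 1 ((starRingEnd ℂ) z * w)
  rw [norm_one] at this
  linarith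

theorem integrable_herglotzTransform (hr : r < 1) (hν : ∀ᵐ z : unitDisc ∂ν, ‖(z : ℂ)‖ ≤ r) {w : ℂ}
    (hw : ‖w‖ ≤ 1) :
    Integrable (fun z : unitDisc =>
      (1 + (starRingEnd ℂ) (z : ℂ) * w) / (1 - (starRingEnd ℂ) (z : ℂ) * w)) ν := by
  refine Integrable.of_bound (C := 2 / (1 - r)) (Measurable.aestronglyMeasurable ?_) ?_
  · have : Measurable fun z : unitDisc => (starRingEnd ℂ) (z : ℂ) :=
      (Complex.continuous_conj.comp continuous_subtype_val).measurable
    fun_prop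
  · filter_upwards [hν] with z hz
    have h1 := le_norm_one_sub_conj_mul hz hw
    rw [norm_div]
    have h2 : ‖1 + (starRingEnd ℂ) (z : ℂ) * w‖ ≤ 2 := by
      refine (norm_add_le _ _).trans ?_
      rw [norm_mul, RCLike.norm_conj, norm_one]
      nlinarith [norm_nonneg w, norm_nonneg (z : ℂ)]
    gcongr
    linarith

theorem differentiableAt_herglotzTransform (hr : r < 1)
    (hν : ∀ᵐ z : unitDisc ∂ν, ‖(z : ℂ)‖ ≤ r) {w : ℂ} (hw : ‖w‖ ≤ 1) :
    DifferentiableAt ℂ (herglotzTransform ν) w := by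
  have hmeas : Measurable fun z : unitDisc => (starRingEnd ℂ) (z : ℂ) :=
    (Complex.continuous_conj.comp continuous_subtype_val).measurable
  -- For `|x| ≤ 1 + ε` and `|z| ≤ r` one has `1 - r(1 + ε) = 2ε - rε ≥ ε`, so the denominators stay
  -- bounded below slightly beyond the closed disc.
  set ε := (1 - r) / 2 with hε
  have hε0 : 0 < ε := by simp only [hε]; linarith
  have key : ∀ z : unitDisc, ‖(z : ℂ)‖ ≤ r → ∀ x ∈ Metric.ball w ε,
      ε ≤ ‖1 - (starRingEnd ℂ) (z : ℂ) * x‖ := by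
    intro z hz x hx
    have hx1 : ‖x‖ ≤ 1 + ε := by
      have := norm_sub_norm_le x w
      rw [Metric.mem_ball, dist_eq_norm] at hx
      linarith
    have h := le_norm_one_sub_conj_mul hz hx1
    nlinarith [norm_nonneg (z : ℂ)]
  refine (hasDerivAt_integral_of_dominated_loc_of_deriv_le (𝕜 := ℂ) (μ := ν)
    (F := fun w (z : unitDisc) =>
      (1 + (starRingEnd ℂ) (z : ℂ) * w) / (1 - (starRingEnd ℂ) (z : ℂ) * w))
    (F' := fun w (z : unitDisc) =>
      2 * (starRingEnd ℂ) (z : ℂ) / (1 - (starRingEnd ℂ) (z : ℂ) * w) ^ 2)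
    (bound := fun _ => 2 / ε ^ 2) (Metric.ball_mem_nhds w hε0) ?_
    (integrable_herglotzTransform hr hν hw) ?_ ?_ (integrable_const _) ?_).2.differentiableAt
  · refine Filter.Eventually.of_forall fun x => Measurable.aestronglyMeasurable ?_
    fun_prop
  · exact Measurable.aestronglyMeasurable (by fun_prop)
  · filter_upwards [hν] with z hz x hx
    have h1 := key z hz x hx
    rw [norm_div, norm_pow, norm_mul, RCLike.norm_conj]
    have h2 : ‖(2 : ℂ)‖ * ‖(z : ℂ)‖ ≤ 2 := by
      rw [RCLike.norm_ofNat]; linarith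
    gcongr
  · filter_upwards [hν] with z hz x hx
    have h1 : 1 - (starRingEnd ℂ) (z : ℂ) * x ≠ 0 := norm_pos_iff.1 (hε0.trans_le (key z hz x hx))
    exact ((((hasDerivAt_id' x).const_mul ((starRingEnd ℂ) (z : ℂ))).const_add 1).div
      (((hasDerivAt_id' x).const_mul ((starRingEnd ℂ) (z : ℂ))).const_sub 1) h1).congr_deriv
      (by ring)

theorem re_one_add_div_one_sub (u : ℂ) :
    ((1 + u) / (1 - u)).re = (1 - ‖u‖ ^ 2) / ‖1 - u‖ ^ 2 := by
  rw [Complex.div_re, ← Complex.normSq_eq_norm_sq, ← Complex.normSq_eq_norm_sq, ← add_div]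
  simp [Complex.normSq_apply]
  ring

theorem ofReal_re_herglotzTransform (hr : r < 1)
    (hν : ∀ᵐ z : unitDisc ∂ν, ‖(z : ℂ)‖ ≤ r) {w : ℂ} (hw : ‖w‖ ≤ 1) :
    ENNReal.ofReal (herglotzTransform ν w).re = ∫⁻ z : unitDisc, ENNReal.ofReal
      ((1 - ‖(z : ℂ)‖ ^ 2 * ‖w‖ ^ 2) / ‖1 - w * (starRingEnd ℂ) (z : ℂ)‖ ^ 2) ∂ν := by
  have hi := integrable_herglotzTransform hr hν hw
  have hre : ∀ z : unitDisc,
      ((1 + (starRingEnd ℂ) (z : ℂ) * w) / (1 - (starRingEnd ℂ) (z : ℂ) * w)).re =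
        (1 - ‖(z : ℂ)‖ ^ 2 * ‖w‖ ^ 2) / ‖1 - w * (starRingEnd ℂ) (z : ℂ)‖ ^ 2 := fun z => by
    rw [re_one_add_div_one_sub, norm_mul, RCLike.norm_conj, mul_pow, mul_comm w]
  rw [herglotzTransform]
  have h1 := integral_re hi
  simp only [RCLike.re_eq_complex_re, hre] at h1
  rw [← h1]
  refine ofReal_integral_eq_lintegral_ofReal ?_ (ae_of_all _ fun z => ?_)
  · have := hi.re
    simpa only [RCLike.re_eq_complex_re, hre] using this
  · have hz : ‖(z : ℂ)‖ < 1 := mem_ball_zero_iff.1 z.2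
    have : ‖(z : ℂ)‖ ^ 2 * ‖w‖ ^ 2 ≤ 1 :=
      mul_le_one₀ (pow_le_one₀ (norm_nonneg _) hz.le) (by positivity)
        (pow_le_one₀ (norm_nonneg _) hw)
    exact div_nonneg (by linarith) (by positivity)

end

/-! ### Outer balayage and the weighted pointwise estimate -/

/-- The balayage to the point `ξ` of the part of `ν` outside the open disc of radius `‖a‖`. -/
noncomputable def outerBalayage (ν : Measure unitDisc) (ξ a : ℂ) : ℝ≥0∞ :=
  ∫⁻ z in {z : unitDisc | ‖a‖ ≤ ‖(z : ℂ)‖}, ‖szegoKernel z ξ‖ₑ ^ 2 ∂ν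

theorem measurable_szegoKernel : Measurable fun q : ℂ × ℂ => szegoKernel q.1 q.2 := by
  have : Measurable fun q : ℂ × ℂ => (starRingEnd ℂ) q.1 :=
    (Complex.continuous_conj.comp continuous_fst).measurable
  unfold szegoKernel
  fun_prop

theorem measurableSet_le_norm (a : ℂ) : MeasurableSet {z : unitDisc | ‖a‖ ≤ ‖(z : ℂ)‖} :=
  measurableSet_le measurable_const (by fun_prop)

theorem measurable_outerBalayage (ν : Measure unitDisc) [SFinite ν] :
    Measurable fun q : ℂ × ℂ => outerBalayage ν q.1 q.2 := by
  have h : ∀ q : ℂ × ℂ, outerBalayage ν q.1 q.2 =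
      ∫⁻ z : unitDisc, {y : (ℂ × ℂ) × unitDisc | ‖y.1.2‖ ≤ ‖(y.2 : ℂ)‖}.indicator
        (fun y => ‖szegoKernel y.2 y.1.1‖ₑ ^ 2) (q, z) ∂ν := fun q => by
    rw [outerBalayage, ← lintegral_indicator (measurableSet_le_norm _)]
    rfl
  simp_rw [h]
  refine Measurable.lintegral_prod_right' (Measurable.indicator ?_
    (measurableSet_le (by fun_prop) (by fun_prop)))
  have h1 : Measurable fun y : (ℂ × ℂ) × unitDisc => ((y.2 : ℂ), y.1.1) := by fun_prop
  exact (measurable_szegoKernel.comp h1).enorm.pow_const 2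

section
variable {ν : Measure unitDisc} [IsFiniteMeasure ν] {r : ℝ}

theorem enorm_szegoKernel_sq_le_of_norm_le {z w : ℂ} (hr : r < 1) (hz : ‖z‖ ≤ r) (hw : ‖w‖ ≤ 1) :
    ‖szegoKernel z w‖ₑ ^ 2 ≤ ENNReal.ofReal (1 / (1 - r) ^ 2) := by
  rw [enorm_szegoKernel_sq (hz.trans_lt hr)]
  have h1 := le_norm_one_sub_conj_mul hz hw
  rw [mul_one, mul_comm ((starRingEnd ℂ) z)] at h1
  have h2 : 0 < 1 - r := by linarith
  have h3 : 1 - ‖z‖ ^ 2 ≤ 1 := by nlinarith [norm_nonneg z]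
  gcongr

theorem lintegral_enorm_szegoKernel_sq_lt_top (hr : r < 1)
    (hν : ∀ᵐ z : unitDisc ∂ν, ‖(z : ℂ)‖ ≤ r) {w : ℂ} (hw : ‖w‖ ≤ 1) :
    ∫⁻ z : unitDisc, ‖szegoKernel z w‖ₑ ^ 2 ∂ν < ∞ := by
  refine (lintegral_mono_ae (g := fun _ => ENNReal.ofReal (1 / (1 - r) ^ 2)) ?_).trans_lt ?_
  · filter_upwards [hν] with z hz using enorm_szegoKernel_sq_le_of_norm_le hr hz hw
  · rw [lintegral_const]
    exact ENNReal.mul_lt_top ENNReal.ofReal_lt_top (measure_lt_top _ _)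

/-- The tail-mass bound for the measure `|k_z(ξ)|² dν(z)` ordered by `|z|`: its tail mass at `a` is
exactly the outer balayage. -/
theorem lintegral_exp_neg_outerBalayage_le (hr : r < 1)
    (hν : ∀ᵐ z : unitDisc ∂ν, ‖(z : ℂ)‖ ≤ r) {ξ : ℂ} (hξ : ‖ξ‖ ≤ 1) {c : ℝ} (hc : 0 < c) :
    ∫⁻ a : unitDisc, ENNReal.ofReal (Real.exp (-(outerBalayage ν ξ a).toReal / c)) *
      ‖szegoKernel a ξ‖ₑ ^ 2 ∂ν ≤ ENNReal.ofReal c := by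
  have hm : Measurable fun z : unitDisc => ‖szegoKernel z ξ‖ₑ ^ 2 := by
    have h1 : Measurable fun z : unitDisc => ((z : ℂ), ξ) := by fun_prop
    exact (measurable_szegoKernel.comp h1).enorm.pow_const 2
  have hf : IsFiniteMeasure (ν.withDensity fun z : unitDisc => ‖szegoKernel z ξ‖ₑ ^ 2) :=
    isFiniteMeasure_withDensity (lintegral_enorm_szegoKernel_sq_lt_top hr hν hξ).ne
  have h := lintegral_exp_neg_measure_ge_le
    (ν.withDensity fun z : unitDisc => ‖szegoKernel z ξ‖ₑ ^ 2)
    (ρ := fun z : unitDisc => ‖(z : ℂ)‖) (by fun_prop) hc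
  have hB : Measurable fun a : unitDisc => outerBalayage ν ξ a := by
    have h1 : Measurable fun z : unitDisc => (ξ, (z : ℂ)) := by fun_prop
    exact (measurable_outerBalayage ν).comp h1
  have he : ∀ a : unitDisc, (ν.withDensity fun z : unitDisc => ‖szegoKernel z ξ‖ₑ ^ 2)
      {y : unitDisc | ‖(a : ℂ)‖ ≤ ‖(y : ℂ)‖} = outerBalayage ν ξ a := fun a =>
    withDensity_apply _ (measurableSet_le_norm _)
  simp_rw [he] at h
  rw [lintegral_withDensity_eq_lintegral_mul _ hm (by fun_prop)] at h
  refine le_trans (le_of_eq (lintegral_congr fun a => ?_)) h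
  exact mul_comm _ _

/-- If `‖a‖ ≤ ‖z‖` then `1 - ‖z‖² ‖a‖² ≤ 2 (1 - ‖a‖²)`, so the harmonic extension to `a` of the
outer balayage is at most twice the kernel test integral at `a`. -/
theorem ofReal_re_herglotzTransform_restrict_le (hr : r < 1)
    (hν : ∀ᵐ z : unitDisc ∂ν, ‖(z : ℂ)‖ ≤ r) {a : ℂ} (ha : ‖a‖ < 1) :
    ENNReal.ofReal
        (herglotzTransform (ν.restrict {z : unitDisc | ‖a‖ ≤ ‖(z : ℂ)‖}) a).re ≤
      2 * ∫⁻ z : unitDisc, ‖szegoKernel a z‖ₑ ^ 2 ∂ν := by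
  rw [ofReal_re_herglotzTransform hr (ae_restrict_of_ae hν) ha.le,
    ← lintegral_const_mul' _ _ ENNReal.ofNat_ne_top]
  refine (setLIntegral_mono' (measurableSet_le_norm a) fun z hz => ?_).trans
    (setLIntegral_le_lintegral _ _)
  have hz : ‖a‖ ≤ ‖(z : ℂ)‖ := hz
  have hz1 : ‖(z : ℂ)‖ < 1 := mem_ball_zero_iff.1 z.2
  rw [enorm_szegoKernel_sq ha, ← ENNReal.ofReal_ofNat 2, ← ENNReal.ofReal_mul zero_le_two,
    ← mul_div_assoc]
  have h1 : ‖1 - (z : ℂ) * (starRingEnd ℂ) a‖ = ‖1 - a * (starRingEnd ℂ) (z : ℂ)‖ := by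
    rw [← RCLike.norm_conj]
    simp [mul_comm]
  rw [h1]
  gcongr
  have h2 : ‖a‖ ^ 2 ≤ ‖(z : ℂ)‖ ^ 2 := by gcongr
  have h3 : ‖a‖ ^ 2 ≤ 1 := by nlinarith [norm_nonneg a]
  -- `1 - |z|²|a|² ≤ 1 - |a|⁴ = (1 - |a|²)(1 + |a|²)`; this is the source of the factor 2.
  nlinarith

theorem enorm_sq_le_lintegral_exp_neg_outerBalayage (hr : r < 1)
    (hν : ∀ᵐ z : unitDisc ∂ν, ‖(z : ℂ)‖ ≤ r) {f : ℂ → ℂ} (hf : Differentiable ℂ f) {c : ℝ}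
    (hc : 0 < c) {a : ℂ} (ha : ‖a‖ < 1)
    (h : 2 * ∫⁻ z : unitDisc, ‖szegoKernel a z‖ₑ ^ 2 ∂ν ≤ ENNReal.ofReal c) :
    ‖f a‖ₑ ^ 2 ≤ ENNReal.ofReal (Real.exp 1) * ∫⁻ t, ‖f (AddCircle.toCircle t)‖ₑ ^ 2 *
      (ENNReal.ofReal (Real.exp (-(outerBalayage ν (AddCircle.toCircle t) a).toReal / c)) *
        ‖szegoKernel a (AddCircle.toCircle t)‖ₑ ^ 2)
        ∂(AddCircle.haarAddCircle (T := 2 * Real.pi)) := by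
  set η := ν.restrict {z : unitDisc | ‖a‖ ≤ ‖(z : ℂ)‖} with hη
  have hη' : ∀ᵐ z : unitDisc ∂η, ‖(z : ℂ)‖ ≤ r := ae_restrict_of_ae hν
  -- The denominator is `2c` because the modulus gets squared: the weight on `|f|²` is then `exp(-Re
  -- H/c)`.
  set g : ℂ → ℂ := fun w => f w * Complex.exp (-(herglotzTransform η w) / (2 * c)) with hg
  have hnorm : ∀ w, ‖g w‖ₑ ^ 2 =
      ‖f w‖ₑ ^ 2 * ENNReal.ofReal (Real.exp (-(herglotzTransform η w).re / c)) := fun w => by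
    rw [hg, enorm_mul, mul_pow, ← ofReal_norm (Complex.exp _), Complex.norm_exp,
      ← ENNReal.ofReal_pow (Real.exp_pos _).le, ← Real.exp_nat_mul]
    congr 3
    rw [show (2 * c : ℂ) = ((2 * c : ℝ) : ℂ) by push_cast; rfl, Complex.div_ofReal_re,
      Complex.neg_re]
    push_cast
    field_simp
  have hd : DiffContOnCl ℂ g (Metric.ball 0 1) := by
    refine DifferentiableOn.diffContOnCl fun w hw => ?_
    rw [closure_ball _ one_ne_zero, mem_closedBall_zero_iff] at hw
    have := differentiableAt_herglotzTransform hr hη' hw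
    refine DifferentiableAt.differentiableWithinAt ?_
    exact (hf w).mul ((this.neg.div_const _).cexp)
  have hmain := enorm_sq_le_lintegral_szegoKernel hd ha
  have hre : (herglotzTransform η a).re ≤ c :=
    (ENNReal.ofReal_le_ofReal_iff hc.le).1
      ((ofReal_re_herglotzTransform_restrict_le hr hν ha).trans h)
  -- Since `Re H(a) ≤ c`, the weight at `a` is at least `1/e`; this is the source of the factor `e`.
  have hlow : ‖f a‖ₑ ^ 2 ≤ ENNReal.ofReal (Real.exp 1) * ‖g a‖ₑ ^ 2 := by
    rw [hnorm, mul_left_comm, ← ENNReal.ofReal_mul (Real.exp_pos _).le, ← Real.exp_add]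
    refine le_mul_of_one_le_right' ?_
    rw [ENNReal.one_le_ofReal, Real.one_le_exp_iff]
    have := (div_le_one hc).2 hre
    rw [neg_div]
    linarith
  refine hlow.trans ?_
  gcongr
  refine hmain.trans (lintegral_mono fun t => le_of_eq ?_)
  have h1 : ‖(AddCircle.toCircle t : ℂ)‖ = 1 := Circle.norm_coe _
  rw [hnorm, mul_assoc]
  have h2 : outerBalayage ν (AddCircle.toCircle t) a =
      ENNReal.ofReal (herglotzTransform η (AddCircle.toCircle t)).re := by
    rw [ofReal_re_herglotzTransform hr hη' h1.le, outerBalayage]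
    refine lintegral_congr fun z => ?_
    rw [enorm_szegoKernel_sq (mem_ball_zero_iff.1 z.2), h1, one_pow, mul_one]
  have h3 : 0 ≤ (herglotzTransform η (AddCircle.toCircle t)).re := by
    rw [herglotzTransform]
    have := integral_re (integrable_herglotzTransform hr hη' h1.le)
    simp only [RCLike.re_eq_complex_re] at this
    rw [← this]
    refine integral_nonneg fun z => ?_
    rw [re_one_add_div_one_sub, norm_mul, RCLike.norm_conj, h1, mul_one]
    have hz : ‖(z : ℂ)‖ < 1 := mem_ball_zero_iff.1 z.2
    have : ‖(z : ℂ)‖ ^ 2 ≤ 1 := pow_le_one₀ (norm_nonneg _) hz.le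
    exact div_nonneg (by linarith) (by positivity)
  rw [h2, ENNReal.toReal_ofReal h3]

/-- Integrate the pointwise estimate over `a` and swap; for each fixed boundary point the remaining
`a`-integral is at most `c`. -/
theorem lintegral_enorm_sq_le_of_norm_le (hr : r < 1)
    (hν : ∀ᵐ z : unitDisc ∂ν, ‖(z : ℂ)‖ ≤ r) {f : ℂ → ℂ} (hf : Differentiable ℂ f) {c : ℝ}
    (hc : 0 < c)
    (h : ∀ᵐ a : unitDisc ∂ν, 2 * ∫⁻ z : unitDisc, ‖szegoKernel a z‖ₑ ^ 2 ∂ν ≤ ENNReal.ofReal c) :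
    ∫⁻ a : unitDisc, ‖f a‖ₑ ^ 2 ∂ν ≤ ENNReal.ofReal (Real.exp 1) * ENNReal.ofReal c *
      ∫⁻ t, ‖f (AddCircle.toCircle t)‖ₑ ^ 2 ∂(AddCircle.haarAddCircle (T := 2 * Real.pi)) := by
  have hfm : Measurable f := hf.continuous.measurable
  have htc : Measurable fun t : AddCircle (2 * Real.pi) => (AddCircle.toCircle t : ℂ) :=
    (continuous_subtype_val.comp AddCircle.continuous_toCircle).measurable
  have hK : Measurable fun q : unitDisc × AddCircle (2 * Real.pi) =>
      ENNReal.ofReal (Real.exp (-(outerBalayage ν (AddCircle.toCircle q.2) q.1).toReal / c)) *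
        ‖szegoKernel q.1 (AddCircle.toCircle q.2)‖ₑ ^ 2 := by
    have h1 : Measurable fun q : unitDisc × AddCircle (2 * Real.pi) =>
        ((AddCircle.toCircle q.2 : ℂ), (q.1 : ℂ)) :=
      (htc.comp measurable_snd).prodMk (by fun_prop)
    have h2 : Measurable fun q : unitDisc × AddCircle (2 * Real.pi) =>
        ((q.1 : ℂ), (AddCircle.toCircle q.2 : ℂ)) :=
      Measurable.prodMk (by fun_prop) (htc.comp measurable_snd)
    have h3 := (measurable_outerBalayage ν).comp h1
    have h4 := (measurable_szegoKernel.comp h2).enorm.pow_const 2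
    exact ((h3.ennreal_toReal.neg.div_const c).exp.ennreal_ofReal).mul h4
  have hF : Measurable fun q : unitDisc × AddCircle (2 * Real.pi) =>
      ‖f (AddCircle.toCircle q.2)‖ₑ ^ 2 *
      (ENNReal.ofReal (Real.exp (-(outerBalayage ν (AddCircle.toCircle q.2) q.1).toReal / c)) *
        ‖szegoKernel q.1 (AddCircle.toCircle q.2)‖ₑ ^ 2) :=
    ((hfm.comp (htc.comp measurable_snd)).enorm.pow_const 2).mul hK
  calc ∫⁻ a : unitDisc, ‖f a‖ₑ ^ 2 ∂ν
      ≤ ∫⁻ a : unitDisc, ENNReal.ofReal (Real.exp 1) *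
          (∫⁻ t, ‖f (AddCircle.toCircle t)‖ₑ ^ 2 *
          (ENNReal.ofReal (Real.exp (-(outerBalayage ν (AddCircle.toCircle t) a).toReal / c)) *
            ‖szegoKernel a (AddCircle.toCircle t)‖ₑ ^ 2)
            ∂(AddCircle.haarAddCircle (T := 2 * Real.pi))) ∂ν := by
        refine lintegral_mono_ae ?_
        filter_upwards [h] with a ha
        exact enorm_sq_le_lintegral_exp_neg_outerBalayage hr hν hf hc
          (mem_ball_zero_iff.1 a.2) ha
    _ = ENNReal.ofReal (Real.exp 1) *
          ∫⁻ t, ‖f (AddCircle.toCircle t)‖ₑ ^ 2 * (∫⁻ a : unitDisc,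
          ENNReal.ofReal (Real.exp (-(outerBalayage ν (AddCircle.toCircle t) a).toReal / c)) *
            ‖szegoKernel a (AddCircle.toCircle t)‖ₑ ^ 2 ∂ν)
            ∂(AddCircle.haarAddCircle (T := 2 * Real.pi)) := by
        rw [lintegral_const_mul' _ _ ENNReal.ofReal_ne_top, lintegral_lintegral_swap hF.aemeasurable]
        congr 1
        refine lintegral_congr fun t => ?_
        rw [lintegral_const_mul' _ _ (by finiteness)]
    _ ≤ ENNReal.ofReal (Real.exp 1) * ∫⁻ t, ‖f (AddCircle.toCircle t)‖ₑ ^ 2 * ENNReal.ofReal c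
            ∂(AddCircle.haarAddCircle (T := 2 * Real.pi)) := by
        gcongr with t
        exact lintegral_exp_neg_outerBalayage_le hr hν (Circle.norm_coe _).le hc
    _ = _ := by
        rw [lintegral_mul_const' _ _ ENNReal.ofReal_ne_top, mul_assoc, mul_comm (ENNReal.ofReal c)]

end

/-! ### Reduction to measures supported away from the circle -/

theorem ae_lintegral_szegoKernel_le (μ : Measure unitDisc) :
    ∀ᵐ a : unitDisc ∂μ, ∫⁻ z : unitDisc, ‖szegoKernel a z‖ₑ ^ 2 ∂μ ≤ kernelTestConst μ := by
  filter_upwards [Measure.support_mem_ae (μ := μ)] with a ha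
  exact le_iSup₂ (f := fun (a : unitDisc) (_ : a ∈ μ.support) =>
    ∫⁻ z : unitDisc, ‖szegoKernel a z‖ₑ ^ 2 ∂μ) a ha

/-- A single point `a` with finite test integral suffices, as `|k_a|² ≥ (1 - |a|²)/4` on the disc.
-/
theorem isFiniteMeasure_of_kernelTestConst_lt_top {μ : Measure unitDisc}
    (h : kernelTestConst μ < ∞) : IsFiniteMeasure μ := by
  rcases eq_or_ne μ 0 with rfl | hμ
  · infer_instance
  have := ae_neBot.2 hμ
  obtain ⟨a, ha⟩ := (ae_lintegral_szegoKernel_le μ).exists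
  have ha1 : ‖(a : ℂ)‖ < 1 := mem_ball_zero_iff.1 a.2
  have hpos : 0 < 1 - ‖(a : ℂ)‖ ^ 2 := by nlinarith [norm_nonneg (a : ℂ)]
  have hle : ENNReal.ofReal ((1 - ‖(a : ℂ)‖ ^ 2) / 2 ^ 2) * μ Set.univ < ∞ := by
    rw [← lintegral_const]
    refine (lintegral_mono fun z => ?_).trans_lt (ha.trans_lt h)
    rw [enorm_szegoKernel_sq ha1]
    have hz1 : ‖(z : ℂ)‖ < 1 := mem_ball_zero_iff.1 z.2
    have hne : 0 < ‖1 - (z : ℂ) * (starRingEnd ℂ) (a : ℂ)‖ := by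
      have := le_norm_one_sub_conj_mul (le_refl ‖(a : ℂ)‖) hz1.le
      rw [mul_comm (z : ℂ)]
      linarith
    have hb : ‖1 - (z : ℂ) * (starRingEnd ℂ) (a : ℂ)‖ ≤ 2 := by
      refine (norm_sub_le _ _).trans ?_
      rw [norm_one, norm_mul, RCLike.norm_conj]
      nlinarith [norm_nonneg (z : ℂ), norm_nonneg (a : ℂ)]
    gcongr
  refine ⟨lt_of_not_ge fun ht => ?_⟩
  rw [top_le_iff.1 ht, ENNReal.mul_top] at hle
  · exact hle.ne rfl
  · simpa using hpos

theorem lintegral_enorm_sq_le_of_differentiable {μ : Measure unitDisc} {c : ℝ} (hc : 0 < c)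
    (h : 2 * kernelTestConst μ ≤ ENNReal.ofReal c) {f : ℂ → ℂ} (hf : Differentiable ℂ f) :
    ∫⁻ a : unitDisc, ‖f a‖ₑ ^ 2 ∂μ ≤ ENNReal.ofReal (Real.exp 1) * ENNReal.ofReal c *
      ∫⁻ t, ‖f (AddCircle.toCircle t)‖ₑ ^ 2 ∂(AddCircle.haarAddCircle (T := 2 * Real.pi)) := by
  have hfin : kernelTestConst μ < ∞ :=
    lt_of_le_of_lt (le_mul_of_one_le_left' one_le_two) (h.trans_lt ENNReal.ofReal_lt_top)
  have := isFiniteMeasure_of_kernelTestConst_lt_top hfin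
  -- Exhaust the disc by closed discs. Restricting `μ` only decreases the test integrals, and they
  -- are needed only at almost every point, so the support of the restriction plays no role.
  set s : ℕ → Set unitDisc := fun n => {z | ‖(z : ℂ)‖ ≤ 1 - 1 / ((n : ℝ) + 1)} with hs
  have hsm : ∀ n, MeasurableSet (s n) := fun n => measurableSet_le (by fun_prop) measurable_const
  have hmono : Monotone s := fun m n hmn z (hz : ‖(z : ℂ)‖ ≤ _) =>
    hz.trans (sub_le_sub_left (Nat.one_div_le_one_div hmn) 1)
  have hU : ⋃ n, s n = Set.univ := by
    refine Set.eq_univ_of_forall fun z => Set.mem_iUnion.2 ?_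
    have hz1 : ‖(z : ℂ)‖ < 1 := mem_ball_zero_iff.1 z.2
    obtain ⟨n, hn⟩ := exists_nat_one_div_lt (sub_pos.2 hz1)
    exact ⟨n, show ‖(z : ℂ)‖ ≤ _ by linarith⟩
  rw [← setLIntegral_univ, ← hU, setLIntegral_iUnion_of_directed _ hmono.directed_le]
  refine iSup_le fun n => ?_
  refine lintegral_enorm_sq_le_of_norm_le (ν := μ.restrict (s n)) (r := 1 - 1 / ((n : ℝ) + 1))
    (sub_lt_self _ (by positivity)) (ae_restrict_mem (hsm n)) hf hc ?_
  filter_upwards [ae_restrict_of_ae (ae_lintegral_szegoKernel_le μ)] with a ha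
  refine le_trans ?_ h
  gcongr
  exact (setLIntegral_le_lintegral _ _).trans ha

/-! ### From polynomials to the Hardy space -/

theorem polyToCircleL2_coeFn (p : Polynomial ℂ) :
    polyToCircleL2 p =ᵐ[AddCircle.haarAddCircle (T := 2 * Real.pi)]
      fun t => p.eval (AddCircle.toCircle t : ℂ) := by
  filter_upwards [ContinuousMap.coeFn_toLp (p := 2) (𝕜 := ℂ)
    (AddCircle.haarAddCircle (T := 2 * Real.pi)) p.toAddCircle] with t ht
  refine ht.trans ?_
  have h : p.toAddCircle t = Polynomial.aeval (AddCircle.toCircle t : ℂ) p :=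
    (Polynomial.aeval_algHom_apply (ContinuousMap.evalAlgHom ℂ ℂ t) _ p).symm
  rw [h, Polynomial.coe_aeval_eq_eval]

theorem discExtension_polyToCircleL2 (p : Polynomial ℂ) (z : ℂ) :
    discExtension (polyToCircleL2 p) z = p.eval z := by
  have h : ∀ n : ℕ, fourierCoeff (polyToCircleL2 p) (n : ℤ) = p.coeff n := fun n => by
    rw [← Polynomial.fourierCoeff_toAddCircle_natCast p n]
    refine integral_congr_ae ?_
    filter_upwards [ContinuousMap.coeFn_toLp (p := 2) (𝕜 := ℂ)
      (AddCircle.haarAddCircle (T := 2 * Real.pi)) p.toAddCircle] with t ht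
    exact congrArg _ ht
  simp_rw [discExtension, h]
  rw [Polynomial.eval_eq_sum_range, tsum_eq_sum]
  intro n hn
  rw [Polynomial.coeff_eq_zero_of_natDegree_lt (by simpa using hn), zero_mul]

theorem enorm_sq_eq_lintegral (f : CircleL2) :
    ‖f‖ₑ ^ 2 = ∫⁻ t, ‖f t‖ₑ ^ 2 ∂(AddCircle.haarAddCircle (T := 2 * Real.pi)) := by
  have h := lintegral_rpow_enorm_eq_rpow_eLpNorm' (q := 2) (f := f)
    (μ := AddCircle.haarAddCircle (T := 2 * Real.pi)) zero_lt_two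
  rw [Lp.enorm_def, eLpNorm_eq_eLpNorm' two_ne_zero ENNReal.ofNat_ne_top, ENNReal.toReal_ofNat]
  simpa only [ENNReal.rpow_two] using h.symm

theorem norm_fourierCoeff_le (f : CircleL2) (n : ℤ) : ‖fourierCoeff f n‖ ≤ ‖f‖ := by
  rw [← fourierBasis_repr]
  exact (lp.norm_apply_le_norm two_ne_zero _ _).trans_eq (LinearIsometryEquiv.norm_map _ _)

/-- Each Fourier coefficient of `f - g` is at most its norm; sum the geometric series. -/
theorem norm_discExtension_sub_le (f g : CircleL2) {z : ℂ} (hz : ‖z‖ < 1) :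
    ‖discExtension f z - discExtension g z‖ ≤ ‖f - g‖ * (1 - ‖z‖)⁻¹ := by
  have hs := summable_geometric_of_lt_one (norm_nonneg z) hz
  have hb : ∀ (f : CircleL2) (n : ℕ), ‖fourierCoeff f (n : ℤ) * z ^ n‖ ≤ ‖f‖ * ‖z‖ ^ n :=
    fun f n => by
      rw [norm_mul, norm_pow]
      gcongr
      exact norm_fourierCoeff_le f n
  have hsum : ∀ f : CircleL2, Summable fun n : ℕ => fourierCoeff f (n : ℤ) * z ^ n := fun f =>
    Summable.of_norm_bounded (hs.mul_left _) (hb f)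
  have hsub : ∀ n : ℤ, fourierCoeff f n - fourierCoeff g n = fourierCoeff (f - g : CircleL2) n :=
    fun n => by
      rw [← fourierBasis_repr, ← fourierBasis_repr, ← fourierBasis_repr, map_sub]
      rfl
  rw [discExtension, discExtension, ← (hsum f).tsum_sub (hsum g),
    ← tsum_geometric_of_lt_one (norm_nonneg z) hz, ← tsum_mul_left]
  refine tsum_of_norm_bounded (hs.mul_left _).hasSum fun n => ?_
  rw [← sub_mul, hsub]
  exact hb _ n

theorem continuous_discExtension {z : ℂ} (hz : ‖z‖ < 1) :
    Continuous fun f : CircleL2 => discExtension f z := by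
  refine continuous_iff_continuousAt.2 fun f => tendsto_iff_norm_sub_tendsto_zero.2 ?_
  have h : Filter.Tendsto (fun g : CircleL2 => ‖g - f‖ * (1 - ‖z‖)⁻¹) (nhds f) (nhds 0) := by
    have : Continuous fun g : CircleL2 => ‖g - f‖ * (1 - ‖z‖)⁻¹ := by fun_prop
    simpa using this.tendsto f
  exact squeeze_zero (fun _ => norm_nonneg _) (fun g => norm_discExtension_sub_le g f hz) h

/-- Polynomials converging in norm converge pointwise in the disc, so Fatou's lemma carries the
bound to the limit. -/
theorem lintegral_discExtension_le {μ : Measure unitDisc} {C : ℝ≥0∞} (hC : C ≠ ∞)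
    (h : ∀ p : Polynomial ℂ, ∫⁻ z : unitDisc, ‖p.eval (z : ℂ)‖ₑ ^ 2 ∂μ ≤
      C * ‖polyToCircleL2 p‖ₑ ^ 2) {f : CircleL2} (hf : f ∈ hardyH2) :
    ∫⁻ z : unitDisc, ‖discExtension f z‖ₑ ^ 2 ∂μ ≤ C * ‖f‖ₑ ^ 2 := by
  obtain ⟨u, hu, hlim⟩ := mem_closure_iff_seq_limit.1 hf
  choose p hp using hu
  have hpt : ∀ z : unitDisc, Filter.Tendsto (fun n => ‖(p n).eval (z : ℂ)‖ₑ ^ 2) Filter.atTop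
      (nhds (‖discExtension f z‖ₑ ^ 2)) := fun z => by
    have h1 := ((continuous_discExtension (mem_ball_zero_iff.1 z.2)).tendsto f).comp hlim
    have h2 := (ENNReal.continuous_pow 2).tendsto _ |>.comp h1.enorm
    refine h2.congr fun n => ?_
    simp only [Function.comp_apply, ← hp, discExtension_polyToCircleL2]
  have hnorm : Filter.Tendsto (fun n => C * ‖u n‖ₑ ^ 2) Filter.atTop (nhds (C * ‖f‖ₑ ^ 2)) :=
    ENNReal.Tendsto.const_mul ((ENNReal.continuous_pow 2).tendsto _ |>.comp hlim.enorm)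
      (Or.inr hC)
  calc ∫⁻ z : unitDisc, ‖discExtension f z‖ₑ ^ 2 ∂μ
      = ∫⁻ z : unitDisc, Filter.liminf (fun n => ‖(p n).eval (z : ℂ)‖ₑ ^ 2) Filter.atTop ∂μ :=
        lintegral_congr fun z => (hpt z).liminf_eq.symm
    _ ≤ Filter.liminf (fun n => ∫⁻ z : unitDisc, ‖(p n).eval (z : ℂ)‖ₑ ^ 2 ∂μ) Filter.atTop :=
        lintegral_liminf_le fun n => by
          have := (p n).continuous.measurable
          fun_prop
    _ ≤ Filter.liminf (fun n => C * ‖u n‖ₑ ^ 2) Filter.atTop := by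
        refine Filter.liminf_le_liminf (Filter.Eventually.of_forall fun n => ?_)
        rw [← hp]
        exact h (p n)
    _ = C * ‖f‖ₑ ^ 2 := hnorm.liminf_eq

theorem lintegral_discExtension_le_of_two_mul_le {μ : Measure unitDisc} {c : ℝ} (hc : 0 < c)
    (h : 2 * kernelTestConst μ ≤ ENNReal.ofReal c) {f : CircleL2} (hf : f ∈ hardyH2) :
    ∫⁻ z : unitDisc, ‖discExtension f z‖ₑ ^ 2 ∂μ ≤
      ENNReal.ofReal (Real.exp 1 * c) * ‖f‖ₑ ^ 2 := by
  refine lintegral_discExtension_le ENNReal.ofReal_ne_top (fun p => ?_) hf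
  rw [ENNReal.ofReal_mul (Real.exp_pos 1).le, enorm_sq_eq_lintegral]
  refine (lintegral_enorm_sq_le_of_differentiable hc h p.differentiable).trans_eq ?_
  congr 1
  refine lintegral_congr_ae ?_
  filter_upwards [polyToCircleL2_coeFn p] with t ht
  rw [ht]

/-- The reproducing kernel thesis for Carleson embeddings, with constant `2e`. -/
theorem theorem0p2 (μ : Measure unitDisc) (A : ℝ≥0∞)
    (hA : kernelTestConst μ = A) (hfin : A < ∞) :
    ∀ f ∈ hardyH2,
      ∫⁻ z : unitDisc, ‖discExtension f z‖ₑ ^ 2 ∂μ ≤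
        ENNReal.ofReal (2 * Real.exp 1) * A * ‖f‖ₑ ^ 2 := by
  intro f hf
  lift A to NNReal using hfin.ne
  -- The weight divides by `c`, so `c` must be positive even when `A = 0`; hence `c = 2A + ε`, with
  -- `ε → 0` afterwards.
  have hbound : ∀ ε : ℝ, 0 < ε → ∫⁻ z : unitDisc, ‖discExtension f z‖ₑ ^ 2 ∂μ ≤
      ENNReal.ofReal (Real.exp 1 * (2 * A + ε)) * ‖f‖ₑ ^ 2 := fun ε hε => by
    refine lintegral_discExtension_le_of_two_mul_le (by positivity) ?_ hf
    rw [hA, ENNReal.ofReal_add (by positivity) hε.le, ENNReal.ofReal_mul zero_le_two]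
    simp
  have hlim : Filter.Tendsto (fun ε : ℝ => ENNReal.ofReal (Real.exp 1 * (2 * A + ε)) * ‖f‖ₑ ^ 2)
      (nhdsWithin 0 (Set.Ioi 0)) (nhds (ENNReal.ofReal (Real.exp 1 * (2 * A + 0)) * ‖f‖ₑ ^ 2)) := by
    refine Filter.Tendsto.mono_left ?_ nhdsWithin_le_nhds
    refine ENNReal.Tendsto.mul_const (ENNReal.tendsto_ofReal ?_) (Or.inr (by finiteness))
    exact Continuous.tendsto (by fun_prop) 0
  have := ge_of_tendsto hlim (eventually_nhdsWithin_of_forall hbound)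
  refine this.trans_eq ?_
  rw [add_zero, ← ENNReal.ofReal_coe_nnreal (p := A),
    ← ENNReal.ofReal_mul (by positivity), ← mul_assoc, mul_comm (Real.exp 1)]
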